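/- Let $d\ge 0$ be an integer, $[d+1]=\{1,\dots,d+1\}$, and let $\Delta_d=\{x\in\mathbb{R}^{d+1} : \sum_i x_i=1,\ x_i\ge 0 \text{ for all } i\in[d+1]\}$ be the standard $d$-simplex. For $J\subseteq[d+1]$ let $\Delta_d^J=\{x\in\Delta_d : x_j=0 \text{ for all } j\notin J\}$ be the corresponding face. (a) Let $\alpha^{(1)},\dots,\alpha^{(d+1)}\colon\Delta_d\to\Delta_d$ be continuous maps such that $\alpha^{(i)}(\Delta_d^J)\subseteq\Delta_d^J$ for every $J\subseteq[d+1]$ and every $i\in[d+1]$. Then there are a point $x\in\Delta_d$ and a permutation $\pi$ of $[d+1]$ such that $\alpha^{(i)}_{\pi(i)}(x)\ge\alpha^{(i)}_j(x)$ for all $i,j\in[d+1]$. (b) (Gale's colorful KKM theorem) For each $i\in[d+1]$ let $A^{(i)}_1,\dots,A^{(i)}_{d+1}$ be (relatively) open subsets of $\Delta_d$ such that $\Delta_d^J\subseteq\bigcup_{j\in J}A^{(i)}_j$ for every $J\subseteq[d+1]$ (in particular, taking $J=[d+1]$, they cover $\Delta_d$). Then there is a permutation $\pi$ of $[d+1]$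 such that $\bigcap_{i=1}^{d+1}A^{(i)}_{\pi(i)}\neq\emptyset$. -/

import Mathlib

/-- The face `Δ_d^J = {x ∈ Δ_d : x_j = 0 for all j ∉ J}` of the standard `d`-simplex
`Δ_d = {x ∈ ℝ^{d+1} : ∑ x_i = 1, x_i ≥ 0}`, as a set of points of `Δ_d`. -/
def simplexFace (d : ℕ) (J : Set (Fin (d + 1))) : Set (stdSimplex ℝ (Fin (d + 1))) :=
  {x | ∀ j, j ∉ J → x.1 j = 0}

/-! Part (b) rests on a colorful Sperner lemma, `exists_bijective_label_of_sperner`. Subdivide the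
simplex barycentrically until its cells are small, subdivide once more, and label the barycenter of
a `k`-dimensional cell by the `k`-th labelling. A fully labelled cell of this last subdivision uses
each labelling once. It exists because subdivision and labelling compose to a chain map mod 2 that
preserves faces, and such a map has odd degree (`rainbow_map_eq_one`). Working with lists,
degenerate ones included, avoids triangulations: each subdivision is a recursive coning, `coned`.

A Lebesgue number (`exists_label_of_cover`) turns open covers into Sperner labellings, which gives
(b). Part (a) follows by applying (b) to the sets where a coordinate is maximal up to `1 / (n + 1)`,
and letting `n` grow by compactness. -/

/-- Chains mod 2 on lists of points; the empty list is the simplex of dimension `-1`. -/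
abbrev ListChain (P : Type*) := List P →₀ ZMod 2

/-! ### Chains mod 2, cones and boundaries -/

namespace ListChain

variable {P Q : Type*}

/-- The chain consisting of one list. -/
noncomputable def of (l : List P) : ListChain P := Finsupp.single l 1

/-- Extension of a map on lists to a linear map on chains. -/
noncomputable def ext {M : Type*} [AddCommGroup M] [Module (ZMod 2) M] (f : List P → M) :
    ListChain P →ₗ[ZMod 2] M := Finsupp.linearCombination (ZMod 2) f

@[simp] lemma ext_of {M : Type*} [AddCommGroup M] [Module (ZMod 2) M] (f : List P → M)
    (l : List P) : ext f (of l) = f l := by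
  simp [ext, of]

lemma hom_ext {M : Type*} [AddCommGroup M] [Module (ZMod 2) M]
    {f g : ListChain P →ₗ[ZMod 2] M} (h : ∀ l, f (of l) = g (of l)) : f = g :=
  Finsupp.lhom_ext' fun l => LinearMap.ext_ring (h l)

/-- The chains supported on a set of lists. -/
noncomputable def on (S : Set (List P)) : Submodule (ZMod 2) (ListChain P) :=
  Submodule.span (ZMod 2) (of '' S)

lemma of_mem_on {S : Set (List P)} {l : List P} (h : l ∈ S) : of l ∈ on S :=
  Submodule.subset_span ⟨l, h, rfl⟩

lemma map_mem_of_on {M : Type*} [AddCommGroup M] [Module (ZMod 2) M] {S : Set (List P)}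
    {f : ListChain P →ₗ[ZMod 2] M} {N : Submodule (ZMod 2) M} (h : ∀ l ∈ S, f (of l) ∈ N)
    {c : ListChain P} (hc : c ∈ on S) : f c ∈ N := by
  have : on S ≤ N.comap f := by
    refine Submodule.span_le.2 ?_
    rintro _ ⟨l, hl, rfl⟩
    exact h l hl
  exact this hc

lemma eqOn_on {M : Type*} [AddCommGroup M] [Module (ZMod 2) M] {S : Set (List P)}
    {f g : ListChain P →ₗ[ZMod 2] M} (h : ∀ l ∈ S, f (of l) = g (of l))
    {c : ListChain P} (hc : c ∈ on S) : f c = g c := by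
  have : on S ≤ LinearMap.eqLocus f g := by
    refine Submodule.span_le.2 ?_
    rintro _ ⟨l, hl, rfl⟩
    exact h l hl
  exact this hc

lemma map_eq_zero_of_on {M : Type*} [AddCommGroup M] [Module (ZMod 2) M] {S : Set (List P)}
    {f : ListChain P →ₗ[ZMod 2] M} (h : ∀ l ∈ S, f (of l) = 0)
    {c : ListChain P} (hc : c ∈ on S) : f c = 0 :=
  eqOn_on (g := 0) h hc

/-- The cone with a given apex. -/
noncomputable def cone (a : P) : ListChain P →ₗ[ZMod 2] ListChain P := ext fun l => of (a :: l)

@[simp] lemma cone_of (a : P) (l : List P) : cone a (of l) = of (a :: l) := ext_of _ _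

/-- The boundary of a list. -/
noncomputable def bdList : List P → ListChain P
  | [] => 0
  | a :: l => of l + cone a (bdList l)

/-- The boundary map. -/
noncomputable def bd : ListChain P →ₗ[ZMod 2] ListChain P := ext bdList

@[simp] lemma bd_nil : bd (of ([] : List P)) = 0 := by simp [bd, bdList]

lemma bd_cons (a : P) (l : List P) : bd (of (a :: l)) = of l + cone a (bd (of l)) := by
  simp [bd, bdList]

lemma bd_cone (a : P) (c : ListChain P) : bd (cone a c) = c + cone a (bd c) := by
  have : bd ∘ₗ cone a = LinearMap.id + cone a ∘ₗ bd := hom_ext fun l => by simp [bd_cons]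
  exact LinearMap.congr_fun this c

lemma add_self (c : ListChain P) : c + c = 0 := by
  rw [← two_smul (ZMod 2) c, show (2 : ZMod 2) = 0 from rfl, zero_smul]

lemma bd_bd_of (l : List P) : bd (bd (of l)) = 0 := by
  induction l with
  | nil => simp
  | cons a l ih => rw [bd_cons, map_add, bd_cone, ih, map_zero, add_zero, add_self]

/-- The boundary of a list is supported on its sublists with one entry fewer. -/
lemma bd_of_mem (l : List P) :
    bd (of l) ∈ on {m | m.Sublist l ∧ m.length + 1 = l.length} := by
  induction l with
  | nil => simp
  | cons a l ih =>
    rw [bd_cons]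
    refine add_mem (of_mem_on ⟨List.sublist_cons_self a l, rfl⟩) (map_mem_of_on ?_ ih)
    rintro m ⟨hm, hl⟩
    rw [cone_of]
    exact of_mem_on ⟨hm.cons_cons a, by simp [hl]⟩

/-! ### Chain maps built by coning -/

/-- Auxiliary form of `coned`, with a bound for the recursion. -/
noncomputable def conedAux (b : List P → Q) : ℕ → ListChain P →ₗ[ZMod 2] ListChain Q
  | 0 => ext fun _ => of []
  | n + 1 => ext fun l => cone (b l) (conedAux b n (bd (of l)))

/-- The chain map which sends a list `l` to the cone with apex `b l` over the image of its
boundary. -/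
noncomputable def coned (b : List P → Q) : ListChain P →ₗ[ZMod 2] ListChain Q :=
  ext fun l => conedAux b l.length (of l)

@[simp] lemma coned_nil (b : List P → Q) : coned b (of []) = of [] := by simp [coned, conedAux]

lemma coned_cons (b : List P → Q) (a : P) (l : List P) :
    coned b (of (a :: l)) = cone (b (a :: l)) (coned b (bd (of (a :: l)))) := by
  have : coned b (bd (of (a :: l))) = conedAux b l.length (bd (of (a :: l))) := by
    refine eqOn_on ?_ (bd_of_mem (a :: l))
    rintro m ⟨-, hm⟩
    simp only [List.length_cons, Nat.add_right_cancel_iff] at hm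
    rw [coned, ext_of, hm]
  rw [this, coned, ext_of, List.length_cons, conedAux, ext_of]

/-- The boundary of a cone is its base plus the cone over the boundary of the base; the second term
vanishes by induction and `bd_bd_of`. -/
lemma bd_coned_of (b : List P → Q) (n : ℕ) :
    ∀ l : List P, l.length = n → bd (coned b (of l)) = coned b (bd (of l)) := by
  induction n with
  | zero => intro l hl; obtain rfl := List.length_eq_zero_iff.1 hl; simp
  | succ n ih =>
    intro l hl
    obtain ⟨a, l, rfl⟩ := List.exists_cons_of_length_eq_add_one hl
    have h : bd (coned b (bd (of (a :: l)))) = coned b (bd (bd (of (a :: l)))) := by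
      refine eqOn_on (f := bd ∘ₗ coned b) (g := coned b ∘ₗ bd) ?_ (bd_of_mem (a :: l))
      rintro m ⟨-, hm⟩
      exact ih m (by omega)
    rw [coned_cons, bd_cone, h, bd_bd_of, map_zero, map_zero, add_zero]

lemma bd_coned (b : List P → Q) (c : ListChain P) : bd (coned b c) = coned b (bd c) := by
  have : bd ∘ₗ coned b = coned b ∘ₗ bd := hom_ext fun l => bd_coned_of b _ l rfl
  exact LinearMap.congr_fun this c

/-- Induction principle for the support of `coned b (of l)`. -/
lemma coned_of_mem {b : List P → Q} {R : List P → List Q → Prop} (h₀ : R [] [])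
    (h₁ : ∀ l l' m, l ≠ [] → l'.Sublist l → l'.length + 1 = l.length → R l' m → R l (b l :: m))
    (l : List P) : coned b (of l) ∈ on {m | R l m} := by
  induction hn : l.length generalizing l with
  | zero =>
    obtain rfl := List.length_eq_zero_iff.1 hn
    rw [coned_nil]; exact of_mem_on h₀
  | succ n ih =>
    obtain ⟨a, l, rfl⟩ := List.exists_cons_of_length_eq_add_one hn
    rw [coned_cons]
    refine map_mem_of_on (f := cone (b (a :: l)) ∘ₗ coned b) ?_ (bd_of_mem (a :: l))
    rintro l' ⟨hs, hl⟩
    refine map_mem_of_on (f := cone (b (a :: l))) ?_ (ih l' (by omega))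
    intro m hm
    rw [cone_of]
    exact of_mem_on (h₁ _ l' m (by simp) hs hl hm)

/-- The lists all of whose entries lie in `S`. -/
def listsIn (S : Set P) : Set (List P) := {l | ∀ x ∈ l, x ∈ S}

lemma coned_mem_listsIn {b : List P → Q} {S : Set P} {T : Set Q}
    (h : ∀ l ∈ listsIn S, l ≠ [] → b l ∈ T) {c : ListChain P} (hc : c ∈ on (listsIn S)) :
    coned b c ∈ on (listsIn T) := by
  refine map_mem_of_on ?_ hc
  intro l hl
  have := coned_of_mem (b := b) (R := fun l m => l ∈ listsIn S → m ∈ listsIn T)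
    (by simp [listsIn]) ?_ l
  · refine map_mem_of_on (f := LinearMap.id) ?_ this
    intro m hm
    exact of_mem_on (hm hl)
  · intro l l' m h0 hs _ ih hl x hx
    rcases List.mem_cons.1 hx with rfl | hx
    · exact h l hl h0
    · exact ih (fun y hy => hl y (hs.subset hy)) x hx

/-! ### Degree mod 2 and Sperner's lemma -/

section Rainbow

variable [DecidableEq P]

/-- The functional that counts mod 2 the lists which enumerate `J` without repetition. -/
noncomputable def rainbow (J : Finset P) : ListChain P →ₗ[ZMod 2] ZMod 2 :=
  ext fun l => if l.Nodup ∧ l.toFinset = J then 1 else 0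

lemma rainbow_of (J : Finset P) (l : List P) :
    rainbow J (of l) = if l.Nodup ∧ l.toFinset = J then 1 else 0 := ext_of _ _

lemma rainbow_of_eq_zero {J : Finset P} {l : List P} {a : P} (h : ¬ (a ∈ l ↔ a ∈ J)) :
    rainbow J (of l) = 0 := by
  rw [rainbow_of, if_neg]
  rintro ⟨-, rfl⟩
  simp at h

lemma rainbow_cone_of_notMem {J : Finset P} {a : P} (h : a ∉ J) (c : ListChain P) :
    rainbow J (cone a c) = 0 := by
  have : rainbow J ∘ₗ cone a = 0 := hom_ext fun l => by
    rw [LinearMap.comp_apply, cone_of, rainbow_of_eq_zero (a := a) (by simp [h])]; rfl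
  exact LinearMap.congr_fun this c

lemma rainbow_cone_of_mem {J : Finset P} {a : P} (h : a ∈ J) (c : ListChain P) :
    rainbow J (cone a c) = rainbow (J.erase a) c := by
  have : rainbow J ∘ₗ cone a = rainbow (J.erase a) := hom_ext fun l => by
    rw [LinearMap.comp_apply, cone_of, rainbow_of, rainbow_of]
    refine if_congr ?_ rfl rfl
    rw [List.nodup_cons, List.toFinset_cons]
    constructor
    · rintro ⟨⟨h1, h2⟩, rfl⟩
      exact ⟨h2, by rw [Finset.erase_insert (by simpa using h1)]⟩
    · rintro ⟨h1, h2⟩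
      refine ⟨⟨fun h3 => ?_, h1⟩, by rw [h2, Finset.insert_erase h]⟩
      have : a ∈ J.erase a := h2 ▸ List.mem_toFinset.2 h3
      simp at this
  exact LinearMap.congr_fun this c

/-- Deleting one entry cannot remove both `a` and `j`. -/
lemma rainbow_bd_eq_zero {a j : P} (haj : a ≠ j) (l : List P) (ha : a ∈ l) (hj : j ∈ l)
    (M : Finset P) (haM : a ∉ M) (hjM : j ∉ M) : rainbow M (bd (of l)) = 0 := by
  induction l generalizing M with
  | nil => simp at ha
  | cons c l ih =>
    rw [bd_cons, map_add]
    have h1 : rainbow M (of l) = 0 := by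
      by_cases hal : a ∈ l
      · exact rainbow_of_eq_zero (a := a) (by simp [hal, haM])
      · have hac : a = c := by simpa [hal] using ha
        have hjl : j ∈ l := by
          rcases List.mem_cons.1 hj with h | h
          · exact absurd (hac.trans h.symm) haj
          · exact h
        exact rainbow_of_eq_zero (a := j) (by simp [hjl, hjM])
    rw [h1, zero_add]
    by_cases hc : c ∈ M
    · have hca : a ≠ c := by rintro rfl; exact haM hc
      have hcj : j ≠ c := by rintro rfl; exact hjM hc
      rw [rainbow_cone_of_mem hc]
      exact ih (by simpa [hca] using ha) (by simpa [hcj] using hj) _ (by simp [haM])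
        (by simp [hjM])
    · exact rainbow_cone_of_notMem hc _

/-- The parity count behind Sperner's lemma: an enumeration of `J` has exactly one facet enumerating
`J.erase j`; any other list in `J` has none, or two that arise by deleting either copy of a repeated
entry. -/
lemma rainbow_bd (l : List P) (J : Finset P) (hl : ∀ x ∈ l, x ∈ J) {j : P} (hj : j ∈ J) :
    rainbow (J.erase j) (bd (of l)) = rainbow J (of l) := by
  induction l generalizing J j with
  | nil => rw [bd_nil, map_zero, rainbow_of_eq_zero (a := j) (by simp [hj])]
  | cons a l ih =>
    have haJ : a ∈ J := hl a (by simp)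
    have hlJ : ∀ x ∈ l, x ∈ J := fun x hx => hl x (by simp [hx])
    rw [bd_cons, map_add, ← cone_of a l, rainbow_cone_of_mem haJ]
    rcases eq_or_ne a j with rfl | haj
    · rw [rainbow_cone_of_notMem (by simp), add_zero]
    have haK : a ∈ J.erase j := by simp [haj, haJ]
    rw [rainbow_cone_of_mem haK]
    by_cases hal : a ∈ l
    · rw [rainbow_of_eq_zero (J := J.erase a) (a := a) (by simp [hal])]
      have key : rainbow ((J.erase j).erase a) (bd (of l)) = rainbow (J.erase j) (of l) := by
        by_cases hjl : j ∈ l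
        · rw [rainbow_bd_eq_zero haj l hal hjl _ (by simp) (by simp),
            rainbow_of_eq_zero (a := j) (by simp [hjl])]
        · refine ih _ (fun x hx => ?_) haK
          rw [Finset.mem_erase]
          exact ⟨fun h => hjl (h ▸ hx), hlJ x hx⟩
      rw [key]
      generalize rainbow (J.erase j) (of l) = t
      revert t; decide
    · rw [rainbow_of_eq_zero (J := J.erase j) (a := a) (by simp [hal, haJ, haj]), zero_add,
        Finset.erase_right_comm]
      refine ih _ (fun x hx => ?_) (by simp [haj.symm, hj])
      rw [Finset.mem_erase]
      exact ⟨fun h => hal (h ▸ hx), hlJ x hx⟩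

/-- **Sperner's lemma** for chain maps: a chain map which carries each face to itself has odd
degree. -/
lemma rainbow_map_eq_one {φ : ListChain P →ₗ[ZMod 2] ListChain P}
    (hφ : ∀ c, bd (φ c) = φ (bd c)) (h₀ : φ (of []) = of [])
    (hJ : ∀ l, φ (of l) ∈ on (listsIn {x | x ∈ l})) (l : List P) (hl : l.Nodup) :
    rainbow l.toFinset (φ (of l)) = 1 := by
  induction l with
  | nil => simp [h₀, rainbow_of]
  | cons j l ih =>
    obtain ⟨hjl, hl⟩ := List.nodup_cons.1 hl
    have h1 : rainbow (j :: l).toFinset (φ (of (j :: l))) =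
        (rainbow ((j :: l).toFinset.erase j) ∘ₗ bd) (φ (of (j :: l))) := by
      refine eqOn_on ?_ (hJ (j :: l))
      intro m hm
      exact (rainbow_bd m _ (fun x hx => List.mem_toFinset.2 (hm x hx)) (by simp)).symm
    rw [h1, LinearMap.comp_apply, hφ, bd_cons, map_add, map_add, List.toFinset_cons,
      Finset.erase_insert (by simpa using hjl), ih hl]
    -- The facets through `j` contribute nothing: each misses some `i ∈ l`, and so does its image
    -- under `φ`.
    convert add_zero _
    refine map_eq_zero_of_on (f := rainbow l.toFinset ∘ₗ φ ∘ₗ cone j) ?_ (bd_of_mem l)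
    rintro m ⟨hm, hlen⟩
    obtain ⟨i, hil, him⟩ : ∃ i ∈ l, i ∉ m := by
      by_contra! h
      have := (hl.subperm h).length_le
      omega
    rw [LinearMap.comp_apply, LinearMap.comp_apply, cone_of]
    refine map_eq_zero_of_on ?_ (hJ (j :: m))
    intro t ht
    refine rainbow_of_eq_zero (a := i) ?_
    have hij : i ≠ j := by rintro rfl; exact hjl hil
    have : i ∉ t := fun h => by simpa [hij, him] using ht i h
    simp [this, hil]

end Rainbow

end ListChain

namespace ListChain

variable {P Q : Type*}

lemma sum_inv_length {l : List P} (h : l ≠ []) :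
    ∑ _i : Fin l.length, (l.length : ℝ)⁻¹ = 1 := by
  have : (l.length : ℝ) ≠ 0 := by simpa using h
  simp [this]

/-! ### Barycentric subdivision and its mesh -/

section Mesh

variable {E : Type*} [NormedAddCommGroup E] [NormedSpace ℝ E]

/-- The barycenter of a list of points. -/
noncomputable def barycenter (l : List E) : E :=
  ∑ i : Fin l.length, (l.length : ℝ)⁻¹ • l.get i

lemma barycenter_mem {S : Set E} (hS : Convex ℝ S) {l : List E} (hl : l ∈ listsIn S)
    (h : l ≠ []) : barycenter l ∈ S :=
  hS.sum_mem (fun _ _ => by positivity) (sum_inv_length h) fun i _ => hl _ (l.get_mem i)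

/-- The lists with entries at mutual distance at most `D`. -/
def meshLE (D : ℝ) : Set (List E) := {l | ∀ x ∈ l, ∀ y ∈ l, dist x y ≤ D}

lemma dist_barycenter_le {D : ℝ} {l : List E} (hl : l ∈ meshLE D) {n : ℕ} (hn : l.length ≤ n)
    {v : E} (hv : v ∈ l) : dist v (barycenter l) ≤ (1 - (n : ℝ)⁻¹) * D := by
  have h0 : l ≠ [] := List.ne_nil_of_mem hv
  have hpos : (0 : ℝ) < l.length := by exact_mod_cast List.length_pos_of_mem hv
  have hD : 0 ≤ D := by simpa using hl v hv v hv
  obtain ⟨i₀, rfl⟩ := List.mem_iff_get.1 hv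
  have h1 : l.get i₀ - barycenter l =
      ∑ i : Fin l.length, (l.length : ℝ)⁻¹ • (l.get i₀ - l.get i) := by
    simp_rw [smul_sub, Finset.sum_sub_distrib, ← Finset.sum_smul, sum_inv_length h0, one_smul]
    rfl
  calc dist (l.get i₀) (barycenter l)
      ≤ ∑ i : Fin l.length, (l.length : ℝ)⁻¹ * dist (l.get i₀) (l.get i) := by
        rw [dist_eq_norm, h1]
        refine (norm_sum_le _ _).trans (Finset.sum_le_sum fun i _ => ?_)
        rw [norm_smul, Real.norm_of_nonneg (by positivity), dist_eq_norm]
    -- The term `i = i₀` is zero; this saves the fraction `1 / l.length` of `D`.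
    _ ≤ ∑ i : Fin l.length, ((l.length : ℝ)⁻¹ * D - if i = i₀ then (l.length : ℝ)⁻¹ * D else 0) := by
        refine Finset.sum_le_sum fun i _ => ?_
        split_ifs with h
        · simp [h]
        · rw [sub_zero]
          exact mul_le_mul_of_nonneg_left (hl _ hv _ (l.get_mem i)) (by positivity)
    _ = (1 - (l.length : ℝ)⁻¹) * D := by
        rw [Finset.sum_sub_distrib, ← Finset.sum_mul, sum_inv_length h0]
        simp [sub_mul]
    _ ≤ (1 - (n : ℝ)⁻¹) * D := by
        have : (l.length : ℝ) ≤ n := by exact_mod_cast hn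
        gcongr

/-- The clause on all convex `S` stands for the convex hull of `l`. Applied to a ball around the new
barycenter, it bounds the distances from the apex to the other entries. -/
lemma coned_barycenter_of_mem (n : ℕ) (D : ℝ) (l : List E) :
    coned barycenter (of l) ∈ on {m | m.length = l.length ∧
      (∀ S, Convex ℝ S → l ∈ listsIn S → m ∈ listsIn S) ∧
      (l.length ≤ n → l ∈ meshLE D → m ∈ meshLE ((1 - (n : ℝ)⁻¹) * D))} := by
  refine coned_of_mem (R := fun l m => m.length = l.length ∧
      (∀ S, Convex ℝ S → l ∈ listsIn S → m ∈ listsIn S) ∧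
      (l.length ≤ n → l ∈ meshLE D → m ∈ meshLE ((1 - (n : ℝ)⁻¹) * D)))
    ⟨rfl, by simp [listsIn], by simp [meshLE]⟩ ?_ l
  rintro l l' m h0 hs hlen ⟨hm, hS, hD⟩
  refine ⟨by simp [hm, hlen], ?_, ?_⟩
  · intro S hSc hl x hx
    rcases List.mem_cons.1 hx with rfl | hx
    · exact barycenter_mem hSc hl h0
    · exact hS S hSc (fun y hy => hl y (hs.subset hy)) x hx
  · intro hn hl
    have hb : m ∈ listsIn (Metric.closedBall (barycenter l) ((1 - (n : ℝ)⁻¹) * D)) :=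
      hS _ (convex_closedBall _ _) fun y hy =>
        Metric.mem_closedBall.2 (dist_barycenter_le hl hn (hs.subset hy))
    have hnn : 0 ≤ (1 - (n : ℝ)⁻¹) * D := by
      obtain ⟨a, ha⟩ := List.exists_mem_of_ne_nil l h0
      exact dist_nonneg.trans (dist_barycenter_le hl hn ha)
    have hm' := hD (by omega) fun x hx y hy => hl x (hs.subset hx) y (hs.subset hy)
    intro x hx y hy
    rcases List.mem_cons.1 hx with rfl | hx <;> rcases List.mem_cons.1 hy with rfl | hy
    · simpa using hnn
    · rw [dist_comm]; exact hb y hy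
    · exact hb x hx
    · exact hm' x hx y hy

lemma coned_barycenter_iterate_mem (n : ℕ) (D : ℝ) {S : Set E} (hS : Convex ℝ S) (k : ℕ)
    {c : ListChain E} (hc : c ∈ on {m | m.length = n ∧ m ∈ listsIn S ∧ m ∈ meshLE D}) :
    (coned barycenter)^[k] c ∈ on {m | m.length = n ∧ m ∈ listsIn S ∧
      m ∈ meshLE ((1 - (n : ℝ)⁻¹) ^ k * D)} := by
  induction k with
  | zero => simpa using hc
  | succ k ih =>
    rw [Function.iterate_succ_apply']
    refine map_mem_of_on ?_ ih
    rintro l ⟨hl, hlS, hlD⟩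
    refine map_mem_of_on (f := LinearMap.id) ?_
      (coned_barycenter_of_mem n ((1 - (n : ℝ)⁻¹) ^ k * D) l)
    rintro m ⟨hm, hmS, hmD⟩
    refine of_mem_on ⟨hm.trans hl, hmS S hS hlS, ?_⟩
    rw [pow_succ', mul_assoc]
    exact hmD hl.le hlD

/-- The support of the last subdivision, where the vertex of a simplex at a barycenter of
dimension `k` is labelled by the `k`-th labelling. -/
lemma coned_label_of_mem (L : ℕ → E → Q) (l : List E) :
    coned (fun l => L (l.length - 1) (barycenter l)) (of l) ∈ on {m | ∃ f : ℕ → E,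
      m = (List.range l.length).reverse.map (fun k => L k (f k)) ∧
      ∀ k < l.length, ∀ S, Convex ℝ S → l ∈ listsIn S → f k ∈ S} := by
  refine coned_of_mem (R := fun l m => ∃ f : ℕ → E,
      m = (List.range l.length).reverse.map (fun k => L k (f k)) ∧
      ∀ k < l.length, ∀ S, Convex ℝ S → l ∈ listsIn S → f k ∈ S)
    ⟨fun _ => 0, by simp, by simp⟩ ?_ l
  rintro l l' m h0 hs hlen ⟨f, rfl, hf⟩
  -- `l'.length` is `l.length - 1`, the dimension of `l`.
  refine ⟨Function.update f l'.length (barycenter l), ?_, ?_⟩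
  · rw [← hlen, List.range_succ, List.reverse_append]
    simp only [List.reverse_cons, List.reverse_nil, List.nil_append, List.singleton_append,
      List.map_cons, Nat.add_sub_cancel, Function.update_self, List.cons.injEq, true_and]
    refine List.map_congr_left fun k hk => ?_
    have : k < l'.length := by simpa using hk
    rw [Function.update_of_ne this.ne]
  · intro k hk S hS hl
    rcases eq_or_ne k l'.length with rfl | hne
    · rw [Function.update_self]; exact barycenter_mem hS hl h0
    · rw [Function.update_of_ne hne]
      exact hf k (by omega) S hS fun y hy => hl y (hs.subset hy)

end Mesh

lemma bd_iterate (b : List P → P) (k : ℕ) (c : ListChain P) :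
    bd ((coned b)^[k] c) = (coned b)^[k] (bd c) := by
  induction k generalizing c with
  | zero => rfl
  | succ k ih => rw [Function.iterate_succ_apply, ih, bd_coned, Function.iterate_succ_apply]

end ListChain

/-! ### Faces and the colorful Sperner lemma -/

/-- The points of the standard simplex that vanish outside `J`. -/
def coordFace {ι : Type*} [Fintype ι] (J : Set ι) : Set (ι → ℝ) :=
  {x | x ∈ stdSimplex ℝ ι ∧ ∀ j, j ∉ J → x j = 0}

lemma convex_coordFace {ι : Type*} [Fintype ι] (J : Set ι) : Convex ℝ (coordFace J) := by
  rintro x ⟨hx, hxJ⟩ y ⟨hy, hyJ⟩ a b ha hb hab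
  refine ⟨convex_stdSimplex ℝ ι hx hy ha hb hab, fun j hj => ?_⟩
  simp [hxJ j hj, hyJ j hj]

lemma single_mem_coordFace {ι : Type*} [Fintype ι] [DecidableEq ι] {J : Set ι} {i : ι}
    (hi : i ∈ J) : Pi.single i (1 : ℝ) ∈ coordFace J := by
  refine ⟨single_mem_stdSimplex ℝ i, fun j hj => ?_⟩
  rw [Pi.single_eq_of_ne]
  rintro rfl
  exact hj hi

lemma dist_le_one_of_mem_stdSimplex {ι : Type*} [Fintype ι] {x y : ι → ℝ}
    (hx : x ∈ stdSimplex ℝ ι) (hy : y ∈ stdSimplex ℝ ι) : dist x y ≤ 1 := by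
  refine (dist_pi_le_iff zero_le_one).2 fun i => ?_
  have h1 := mem_Icc_of_mem_stdSimplex hx i
  have h2 := mem_Icc_of_mem_stdSimplex hy i
  rw [Real.dist_eq, abs_le]
  constructor <;> linarith [h1.1, h1.2, h2.1, h2.2]

open ListChain in
/-- **Colorful Sperner lemma**: given `d + 1` Sperner labellings of the points of the simplex,
there are points at small mutual distance, the labels of which are all different. -/
theorem exists_bijective_label_of_sperner (d : ℕ)
    (L : Fin (d + 1) → (Fin (d + 1) → ℝ) → Fin (d + 1))
    (hL : ∀ i, ∀ x ∈ stdSimplex ℝ (Fin (d + 1)), x (L i x) ≠ 0) {ε : ℝ} (hε : 0 < ε) :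
    ∃ v : Fin (d + 1) → Fin (d + 1) → ℝ, (∀ i, v i ∈ stdSimplex ℝ (Fin (d + 1))) ∧
      (∀ i j, dist (v i) (v j) ≤ ε) ∧ Function.Bijective fun i => L i (v i) := by
  have hq : (1 - ((d + 1 : ℕ) : ℝ)⁻¹) < 1 := by
    have : 0 < ((d + 1 : ℕ) : ℝ)⁻¹ := by positivity
    linarith
  obtain ⟨k, hk⟩ := exists_pow_lt_of_lt_one hε hq
  -- Reduction mod `d + 1` only makes `K` total; the final count uses `n ≤ d`.
  set K : ℕ → (Fin (d + 1) → ℝ) → Fin (d + 1) := fun n => L (Fin.ofNat (d + 1) n) with hKdef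
  set b₀ : List (Fin (d + 1)) → Fin (d + 1) → ℝ :=
    fun l => barycenter (l.map fun i => Pi.single i 1) with hb₀
  set b₁ : List (Fin (d + 1) → ℝ) → Fin (d + 1) :=
    fun l => K (l.length - 1) (barycenter l) with hb₁
  have hb₀mem : ∀ (J : Set (Fin (d + 1))), ∀ l ∈ listsIn J, l ≠ [] → b₀ l ∈ coordFace J := by
    intro J l hl h0
    refine barycenter_mem (convex_coordFace J) ?_ (by simpa using h0)
    intro x hx
    obtain ⟨i, hi, rfl⟩ := List.mem_map.1 hx
    exact single_mem_coordFace (hl i hi)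
  have hb₁mem : ∀ (J : Set (Fin (d + 1))), ∀ l ∈ listsIn (coordFace J), l ≠ [] → b₁ l ∈ J := by
    intro J l hl h0
    have h := barycenter_mem (convex_coordFace J) hl h0
    by_contra hJ
    exact hL _ _ h.1 (h.2 _ hJ)
  set φ : ListChain (Fin (d + 1)) →ₗ[ZMod 2] ListChain (Fin (d + 1)) :=
    coned b₁ ∘ₗ ((coned barycenter) ^ k : Module.End (ZMod 2) _) ∘ₗ coned b₀ with hφ
  have hφa : ∀ c, φ c = coned b₁ ((coned barycenter)^[k] (coned b₀ c)) := fun c => by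
    simp [hφ, Module.End.pow_apply]
  have h1 : rainbow (List.finRange (d + 1)).toFinset (φ (of (List.finRange (d + 1)))) = 1 := by
    refine rainbow_map_eq_one ?_ ?_ ?_ _ (List.nodup_finRange _)
    · intro c
      rw [hφa, hφa, bd_coned, bd_iterate, bd_coned]
    · rw [hφa, coned_nil, Function.iterate_fixed (coned_nil _), coned_nil]
    · intro l
      rw [hφa]
      have hl : coned b₀ (of l) ∈ on (listsIn (coordFace {x | x ∈ l})) :=
        coned_mem_listsIn (hb₀mem _) (of_mem_on fun x hx => hx)
      refine coned_mem_listsIn (hb₁mem _) ?_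
      exact Function.Iterate.rec (fun c => c ∈ on (listsIn (coordFace {x | x ∈ l}))) hl (fun c hc =>
        coned_mem_listsIn (fun _ => barycenter_mem (convex_coordFace _)) hc) k
  by_contra! hno
  refine one_ne_zero (h1.symm.trans ?_)
  rw [hφa]
  have hc : coned b₀ (of (List.finRange (d + 1))) ∈ on {m | m.length = d + 1 ∧
      m ∈ listsIn (stdSimplex ℝ (Fin (d + 1))) ∧ m ∈ meshLE 1} := by
    have h2 := coned_of_mem (b := b₀)
      (R := fun l m => m.length = l.length ∧ m ∈ listsIn (stdSimplex ℝ (Fin (d + 1))))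
      ⟨rfl, by simp [listsIn]⟩ ?_ (List.finRange (d + 1))
    · refine map_mem_of_on (f := LinearMap.id) ?_ h2
      rintro m ⟨hm, hmS⟩
      exact of_mem_on ⟨by simpa using hm, hmS, fun x hx y hy =>
        dist_le_one_of_mem_stdSimplex (hmS x hx) (hmS y hy)⟩
    · rintro l l' m h0 - hlen ⟨hm, hmS⟩
      refine ⟨by simp [hm, hlen], fun x hx => ?_⟩
      rcases List.mem_cons.1 hx with rfl | hx
      · exact (hb₀mem Set.univ l (fun _ _ => trivial) h0).1
      · exact hmS x hx
  have hc' := coned_barycenter_iterate_mem (d + 1) 1 (convex_stdSimplex ℝ _) k hc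
  refine map_eq_zero_of_on (f := rainbow (List.finRange (d + 1)).toFinset ∘ₗ coned b₁) ?_ hc'
  rintro l ⟨hlen, hlS, hlD⟩
  rw [LinearMap.comp_apply]
  refine map_eq_zero_of_on ?_ (coned_label_of_mem K l)
  rintro m ⟨f, rfl, hf⟩
  rw [hlen] at hf
  rw [rainbow_of, if_neg]
  rintro ⟨-, hfin⟩
  have hlε : l ∈ meshLE ε := fun x hx y hy => (hlD x hx y hy).trans (by simpa using hk.le)
  refine hno (fun i => f i) (fun i => hf i i.2 _ (convex_stdSimplex ℝ _) hlS) ?_ ?_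
  · intro i j
    -- Convexity of balls, used twice, carries the diameter bound from `l` to its hull.
    refine hf i i.2 _ (convex_closedBall (f j) ε) fun x hx => ?_
    rw [Metric.mem_closedBall, dist_comm]
    exact hf j j.2 _ (convex_closedBall x ε) fun y hy => hlε y hy x hx
  · refine Finite.injective_iff_bijective.1 (Finite.injective_iff_surjective.2 fun j => ?_)
    have hj : j ∈ (List.finRange (d + 1)).toFinset := by simp
    rw [← hfin, List.mem_toFinset, List.mem_map] at hj
    obtain ⟨n, hn, rfl⟩ := hj
    have hn : n < d + 1 := by simpa [hlen] using hn
    exact ⟨⟨n, hn⟩, by simp only [hKdef]; congr; exact (Nat.mod_eq_of_lt hn).symm⟩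

/-! ### Colorful KKM and maximal coordinates -/

/-- Take a Lebesgue number on every face and minimize over the finitely many pairs of a cover and a
face. Using the face that supports `x` forces `x.1 j ≠ 0`, the Sperner condition. -/
lemma exists_label_of_cover {d : ℕ} {A : Fin (d + 1) → Fin (d + 1) → Set (stdSimplex ℝ (Fin (d + 1)))}
    (hA : ∀ i j, IsOpen (A i j))
    (hc : ∀ (J : Set (Fin (d + 1))) (i : Fin (d + 1)), simplexFace d J ⊆ ⋃ j ∈ J, A i j) :
    ∃ δ > 0, ∀ i (x : stdSimplex ℝ (Fin (d + 1))), ∃ j, x.1 j ≠ 0 ∧ Metric.ball x δ ⊆ A i j := by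
  have h : ∀ p : Fin (d + 1) × Set (Fin (d + 1)), ∃ δ > 0, ∀ x ∈ simplexFace d p.2,
      ∃ j : p.2, Metric.ball x δ ⊆ A p.1 j := by
    rintro ⟨i, J⟩
    refine lebesgue_number_lemma_of_metric (IsClosed.isCompact ?_) (fun j => hA i j) ?_
    · simp only [simplexFace, Set.ofPred_forall]
      refine isClosed_iInter fun j => isClosed_iInter fun _ => ?_
      exact isClosed_eq ((continuous_apply j).comp continuous_subtype_val) continuous_const
    · rw [Set.iUnion_subtype]
      exact hc J i
  choose δ hδ h using h
  obtain ⟨p, hp⟩ := Finite.exists_min δ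
  refine ⟨δ p, hδ p, fun i x => ?_⟩
  obtain ⟨⟨j, hj⟩, hb⟩ := h (i, {j | x.1 j ≠ 0}) x fun j hj => by simpa using hj
  exact ⟨j, hj, (Metric.ball_subset_ball (hp _)).trans hb⟩

/-- **Gale's colorful KKM theorem** for open covers. -/
theorem colorful_kkm {d : ℕ} {A : Fin (d + 1) → Fin (d + 1) → Set (stdSimplex ℝ (Fin (d + 1)))}
    (hA : ∀ i j, IsOpen (A i j))
    (hc : ∀ (J : Set (Fin (d + 1))) (i : Fin (d + 1)), simplexFace d J ⊆ ⋃ j ∈ J, A i j) :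
    ∃ π : Equiv.Perm (Fin (d + 1)), (⋂ i, A i (π i)).Nonempty := by
  obtain ⟨δ, hδ, h⟩ := exists_label_of_cover hA hc
  choose L hL hball using h
  classical
  obtain ⟨v, hv, hd, hbij⟩ := exists_bijective_label_of_sperner d
    (fun i x => if hx : x ∈ stdSimplex ℝ (Fin (d + 1)) then L i ⟨x, hx⟩ else 0)
    (fun i x hx => by rw [dif_pos hx]; exact hL i ⟨x, hx⟩) (half_pos hδ)
  refine ⟨Equiv.ofBijective _ hbij, ⟨v 0, hv 0⟩, Set.mem_iInter.2 fun i => ?_⟩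
  simp only [Equiv.ofBijective_apply, dif_pos (hv i)]
  refine hball i _ ?_
  rw [Metric.mem_ball, Subtype.dist_eq]
  exact (hd 0 i).trans_lt (half_lt_self hδ)

lemma exists_forall_of_antitone {ι : Type*} [Finite ι] {p : ℕ → ι → Prop}
    (hp : ∀ i m n, m ≤ n → p n i → p m i) (h : ∀ n, ∃ i, p n i) : ∃ i, ∀ n, p n i := by
  by_contra! hno
  choose N hN using hno
  obtain ⟨M, hM⟩ := (Set.finite_range N).bddAbove
  obtain ⟨i, hi⟩ := h M
  exact hN i (hp i _ _ (hM ⟨i, rfl⟩) hi)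

/-- Colorful KKM theorem for the sets of points at which a given coordinate is maximal. -/
theorem exists_perm_coord_max {d : ℕ}
    {α : Fin (d + 1) → stdSimplex ℝ (Fin (d + 1)) → stdSimplex ℝ (Fin (d + 1))}
    (hα : ∀ i, Continuous (α i))
    (hJ : ∀ (J : Set (Fin (d + 1))) (i : Fin (d + 1)),
      α i '' simplexFace d J ⊆ simplexFace d J) :
    ∃ (x : stdSimplex ℝ (Fin (d + 1))) (π : Equiv.Perm (Fin (d + 1))),
      ∀ i j, (α i x).1 j ≤ (α i x).1 (π i) := by
  have hcont : ∀ i j, Continuous fun x => (α i x).1 j := fun i j =>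
    (continuous_apply j).comp (continuous_subtype_val.comp (hα i))
  let p : ℕ → stdSimplex ℝ (Fin (d + 1)) → Equiv.Perm (Fin (d + 1)) → Prop := fun n x π =>
    ∀ i j, (α i x).1 j ≤ (α i x).1 (π i) + 1 / ((n : ℝ) + 1)
  have hmono : ∀ x π m n, m ≤ n → p n x π → p m x π := by
    intro x π m n hmn h i j
    have := Nat.one_div_le_one_div (α := ℝ) hmn
    linarith [h i j]
  have hne : ∀ n, {x | ∃ π, p n x π}.Nonempty := by
    intro n
    have hn : 0 < 1 / ((n : ℝ) + 1) := Nat.one_div_pos_of_nat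
    have h := colorful_kkm (d := d)
      (A := fun i j => {x | ∀ k, (α i x).1 k < (α i x).1 j + 1 / ((n : ℝ) + 1)}) ?_ ?_
    · obtain ⟨π, x, hx⟩ := h
      exact ⟨x, π, fun i j => (Set.mem_iInter.1 hx i j).le⟩
    · intro i j
      rw [Set.ofPred_forall]
      exact isOpen_iInter_of_finite fun k =>
        isOpen_lt (hcont i k) ((hcont i j).add continuous_const)
    · intro J i x hx
      obtain ⟨j, hj⟩ := Finite.exists_max (α i x).1
      refine Set.mem_biUnion (x := j) ?_ fun k => by linarith [hj k]
      -- A maximal coordinate outside `J` would be zero, contradicting that the coordinates sum to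
      -- 1.
      by_contra hjJ
      have h0 : (α i x).1 j = 0 := hJ J i ⟨x, hx, rfl⟩ j hjJ
      have h1 : ∑ k, (α i x).1 k ≤ 0 := Finset.sum_nonpos fun k _ => h0 ▸ hj k
      linarith [(α i x).2.2]
  have hclosed : ∀ n, IsClosed {x | ∃ π, p n x π} := by
    intro n
    simp only [Set.ofPred_exists, p, Set.ofPred_forall]
    exact isClosed_iUnion_of_finite fun π => isClosed_iInter fun i => isClosed_iInter fun j =>
      isClosed_le (hcont i j) ((hcont i (π i)).add continuous_const)
  obtain ⟨x, hx⟩ := IsCompact.nonempty_iInter_of_sequence_nonempty_isCompact_isClosed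
    (fun n => {x | ∃ π, p n x π}) (fun n x ⟨π, h⟩ => ⟨π, hmono x π _ _ n.le_succ h⟩) hne
    (hclosed 0).isCompact hclosed
  -- The permutation still depends on `n`; as there are finitely many, one serves every `n`.
  obtain ⟨π, hπ⟩ := exists_forall_of_antitone (hmono x) (Set.mem_iInter.1 hx)
  refine ⟨x, π, fun i j => ?_⟩
  refine le_of_forall_pos_le_add fun ε hε => ?_
  obtain ⟨n, hn⟩ := exists_nat_one_div_lt hε
  linarith [hπ n i j]

theorem mainTheorem7 (d : ℕ) :
    (∀ α : Fin (d + 1) → stdSimplex ℝ (Fin (d + 1)) → stdSimplex ℝ (Fin (d + 1)),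
      (∀ i, Continuous (α i)) →
      (∀ (J : Set (Fin (d + 1))) (i : Fin (d + 1)),
        α i '' simplexFace d J ⊆ simplexFace d J) →
      ∃ (x : stdSimplex ℝ (Fin (d + 1))) (π : Equiv.Perm (Fin (d + 1))),
        ∀ i j, (α i x).1 j ≤ (α i x).1 (π i)) ∧
    (∀ A : Fin (d + 1) → Fin (d + 1) → Set (stdSimplex ℝ (Fin (d + 1))),
      (∀ i j, IsOpen (A i j)) →
      (∀ (J : Set (Fin (d + 1))) (i : Fin (d + 1)),
        simplexFace d J ⊆ ⋃ j ∈ J, A i j) →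
      ∃ π : Equiv.Perm (Fin (d + 1)), (⋂ i, A i (π i)).Nonempty) := by
  exact ⟨fun _ hα hJ => exists_perm_coord_max hα hJ, fun _ hA hc => colorful_kkm hA hc⟩
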